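/- Graphs may have loops and multiple edges, and a connected graph is regarded as a geodesic metric space with its simplicial metric, in which every edge has length $1$; $V(X)$ denotes the vertex set of $X$. A geodesic metric space is called $\delta$-hyperbolic if each side of every geodesic triangle lies in the closed $\delta$-neighbourhood of the union of the two other sides. A subset $A$ of it is called $C$-quasiconvex if every geodesic joining two points of $A$ lies in the closed $C$-neighbourhood of $A$. Two subsets are called $H$-Hausdorff close if their Hausdorff distance is at most $H$. For all real numbers $\delta_0$ and $C>0$ there exist constants $\delta_1>0$ and $H>0$, depending only on $C$ and $\delta_0$, such that the following holds. Let $X$ be a connected graph with simplicial metric $d_X$ such that $(X,d_X)$ is $\delta_0$-hyperbolic, and let $(X_j)_{j\in J}$ be a family of subgraphs of $X$ such that each $X_j$ is a $C$-quasiconvex subset of $X$. Let $Y$ be the graph obtained from $X$ by adding to $X$ a new edge $e_{x,y,j}$ with endpoints $x$ and $y$ for every $j\in J$ and all vertices $x,y$ of $X_j$ (so $X$ is a subgraph of $Y$), and let $d_Y$ be the simplicial metric on $Y$. Then: 1. $(Y,d_Y)$ is $\delta_1$-hyperbolic. 2. Whenever $x,y\in V(X)$, $[x,y]_X$ is a $d_X$-geodesic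 from $x$ to $y$ in $X$, and $[x,y]_Y$ is a $d_Y$-geodesic from $x$ to $y$ in $Y$, the sets $[x,y]_X$ and $[x,y]_Y$ are $H$-Hausdorff close in $(Y,d_Y)$. -/

import Mathlib

universe u v w

/-- A graph with vertex set `V` and edge set `E`; loops and multiple edges are allowed.
Every edge is given with an (arbitrary) orientation, which serves only to parametrize it by
the interval `[0, 1]` from `src e` to `tgt e`. -/
structure Multigraph (V : Type u) (E : Type v) where
  src : E → V
  tgt : E → V

namespace Multigraph

variable {V : Type u} {E : Type v}

/-- The simple graph on the same vertices in which two distinct vertices are adjacent when some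
edge joins them (in either orientation). It has the same connectivity and the same
combinatorial distance between vertices. -/
def toSimpleGraph (G : Multigraph V E) : SimpleGraph V :=
  SimpleGraph.fromRel fun x y => ∃ e, G.src e = x ∧ G.tgt e = y

/-- A connected (in particular nonempty) graph. -/
class Connected (G : Multigraph V E) : Prop where
  connected : G.toSimpleGraph.Connected

/-- The points of the graph as a one-dimensional complex: the vertices, and for every edge `e` the
points `inner e t` of its interior, `t ∈ (0, 1)` being the distance travelled from `src e`. -/
inductive Realization (G : Multigraph V E) : Type (max u v)
  | vert (x : V) : Realization G
  | inner (e : E) (t : Set.Ioo (0 : ℝ) 1) : Realization G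

namespace Realization

variable {G : Multigraph V E}

/-- The vertex that is reached from a point by leaving its edge at the beginning (`false`) or
at the end (`true`); a vertex is already there. -/
def exit : Realization G → Bool → V
  | vert x, _ => x
  | inner e _, false => G.src e
  | inner e _, true => G.tgt e

/-- The distance along the edge from a point to the vertex `exit p b`. -/
def cost : Realization G → Bool → ℝ
  | vert _, _ => 0
  | inner _ t, false => t
  | inner _ t, true => 1 - t

/-- Length of a shortest path from `p` to `q` that leaves the edge of `p` at its end `b` and
enters the edge of `q` at its end `c`. -/
noncomputable def via (p q : Realization G) (b c : Bool) : ℝ :=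
  p.cost b + G.toSimpleGraph.dist (p.exit b) (q.exit c) + q.cost c

/-- Length of a shortest path from `p` to `q` through vertices. -/
noncomputable def outer (p q : Realization G) : ℝ :=
  min (min (via p q false false) (via p q false true))
    (min (via p q true false) (via p q true true))

open Classical in
/-- The simplicial metric (the path metric in which every edge has length `1`): a shortest path
either passes through vertices or stays inside one edge. -/
noncomputable def simplicialDist : Realization G → Realization G → ℝ
  | inner e s, inner e' t =>
      if e = e' then min |(s : ℝ) - t| (outer (inner e s : Realization G) (inner e' t))
      else outer (inner e s : Realization G) (inner e' t)
  | p, q => outer p q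

theorem outer_le (p q : Realization G) (b c : Bool) : outer p q ≤ via p q b c := by
  cases b <;> cases c <;> simp [outer]

theorem exists_outer (p q : Realization G) : ∃ b c, outer p q = via p q b c := by
  unfold outer
  rcases min_choice (min (via p q false false) (via p q false true))
    (min (via p q true false) (via p q true true)) with h | h <;> rw [h]
  · rcases min_choice (via p q false false) (via p q false true) with h | h <;>
      exact ⟨_, _, h⟩
  · rcases min_choice (via p q true false) (via p q true true) with h | h <;>
      exact ⟨_, _, h⟩

theorem cost_nonneg (p : Realization G) (b : Bool) : 0 ≤ p.cost b := by
  rcases p with x | ⟨e, t, h0, h1⟩ <;> cases b <;> simp [cost] <;> linarith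

theorem cost_inner_pos (e : E) (t : Set.Ioo (0 : ℝ) 1) (b : Bool) :
    0 < (inner e t : Realization G).cost b := by
  rcases t with ⟨t, h0, h1⟩; cases b <;> simp [cost] <;> linarith

theorem via_nonneg (p q : Realization G) (b c : Bool) : 0 ≤ via p q b c := by
  have := cost_nonneg p b
  have := cost_nonneg q c
  unfold via; positivity

theorem outer_nonneg (p q : Realization G) : 0 ≤ outer p q := by
  obtain ⟨b, c, h⟩ := exists_outer p q
  rw [h]; exact via_nonneg p q b c

theorem outer_comm (p q : Realization G) : outer p q = outer q p := by
  have key : ∀ p q : Realization G, outer p q ≤ outer q p := by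
    intro p q
    obtain ⟨b, c, h⟩ := exists_outer q p
    rw [h]
    refine (outer_le p q c b).trans (le_of_eq ?_)
    unfold via
    rw [SimpleGraph.dist_comm]; ring
  exact le_antisymm (key p q) (key q p)

theorem dist_src_tgt (G : Multigraph V E) (e : E) :
    G.toSimpleGraph.dist (G.src e) (G.tgt e) ≤ 1 := by
  by_cases h : G.src e = G.tgt e
  · simp [h]
  · have : G.toSimpleGraph.Adj (G.src e) (G.tgt e) := by
      simp only [toSimpleGraph, SimpleGraph.fromRel_adj]
      exact ⟨h, Or.inl ⟨e, rfl, rfl⟩⟩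
    rw [SimpleGraph.dist_eq_one_iff_adj.2 this]

theorem dist_exit_le (q : Realization G) (b c : Bool) :
    (G.toSimpleGraph.dist (q.exit b) (q.exit c) : ℝ) ≤ q.cost b + q.cost c := by
  rcases q with x | ⟨e, t, h0, h1⟩
  · simp [exit, cost]
  · have h : (G.toSimpleGraph.dist (G.src e) (G.tgt e) : ℝ) ≤ 1 := by
      exact_mod_cast dist_src_tgt G e
    have h' : (G.toSimpleGraph.dist (G.tgt e) (G.src e) : ℝ) ≤ 1 := by
      rw [SimpleGraph.dist_comm]; exact h
    cases b <;> cases c <;> simp only [exit, cost, SimpleGraph.dist_self, Nat.cast_zero] <;>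
      linarith

theorem outer_triangle [hG : G.Connected] (p q r : Realization G) :
    outer p r ≤ outer p q + outer q r := by
  obtain ⟨b, c, h⟩ := exists_outer p q
  obtain ⟨c', d, h'⟩ := exists_outer q r
  rw [h, h']
  refine (outer_le p r b d).trans ?_
  have h1 : (G.toSimpleGraph.dist (p.exit b) (r.exit d) : ℝ) ≤
      G.toSimpleGraph.dist (p.exit b) (q.exit c) + G.toSimpleGraph.dist (q.exit c) (q.exit c')
        + G.toSimpleGraph.dist (q.exit c') (r.exit d) := by
    exact_mod_cast (hG.connected.dist_triangle (v := q.exit c')).trans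
      (Nat.add_le_add_right hG.connected.dist_triangle _)
  have h2 := dist_exit_le q c c'
  unfold via
  linarith

theorem outer_slide (e : E) (s t : Set.Ioo (0 : ℝ) 1) (r : Realization G) :
    outer (inner e s) r ≤ |(s : ℝ) - t| + outer (inner e t) r := by
  obtain ⟨b, c, h⟩ := exists_outer (inner e t) r
  rw [h]
  refine (outer_le _ _ b c).trans ?_
  have h1 := le_abs_self ((s : ℝ) - t)
  have h2 := neg_abs_le ((s : ℝ) - t)
  cases b <;> simp [via, cost, exit] <;> linarith

theorem simplicialDist_le_outer (p q : Realization G) : simplicialDist p q ≤ outer p q := by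
  cases p <;> cases q <;> simp only [simplicialDist, le_refl]
  split_ifs
  · exact min_le_right _ _
  · exact le_rfl

theorem simplicialDist_inner_le (e : E) (s t : Set.Ioo (0 : ℝ) 1) :
    simplicialDist (inner e s : Realization G) (inner e t) ≤ |(s : ℝ) - t| := by
  simp [simplicialDist]

theorem simplicialDist_cases (p q : Realization G) :
    simplicialDist p q = outer p q ∨
      ∃ e s t, p = inner e s ∧ q = inner e t ∧ simplicialDist p q = |(s : ℝ) - t| := by
  rcases p with x | ⟨e, s⟩ <;> rcases q with y | ⟨e', t⟩ <;> try exact Or.inl rfl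
  by_cases h : e = e'
  · subst h
    rcases min_choice |(s : ℝ) - t| (outer (inner e s : Realization G) (inner e t)) with h | h
    · exact Or.inr ⟨e, s, t, rfl, rfl, by simpa [simplicialDist] using h⟩
    · exact Or.inl (by simpa [simplicialDist] using h)
  · exact Or.inl (by simp [simplicialDist, h])

theorem simplicialDist_self (p : Realization G) : simplicialDist p p = 0 := by
  rcases p with x | ⟨e, s⟩
  · simp [simplicialDist, outer, via, cost, exit]
  · simp [simplicialDist, outer_nonneg]

theorem simplicialDist_comm (p q : Realization G) :
    simplicialDist p q = simplicialDist q p := by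
  rcases p with x | ⟨e, s⟩ <;> rcases q with y | ⟨e', t⟩ <;>
    try exact outer_comm _ _
  by_cases h : e = e'
  · subst h
    simp only [simplicialDist, if_true]
    rw [abs_sub_comm, outer_comm]
  · simp only [simplicialDist, h, Ne.symm h, if_false]
    exact outer_comm _ _

theorem simplicialDist_triangle [G.Connected] (p q r : Realization G) :
    simplicialDist p r ≤ simplicialDist p q + simplicialDist q r := by
  rcases simplicialDist_cases p q with h | ⟨e, s, t, h3, h4, h⟩ <;>
    rcases simplicialDist_cases q r with h' | ⟨e', s', t', h1, h2, h'⟩ <;> rw [h, h']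
  · exact (simplicialDist_le_outer p r).trans (outer_triangle p q r)
  · subst h1 h2
    refine (simplicialDist_le_outer _ _).trans ?_
    rw [outer_comm p, outer_comm p, abs_sub_comm, add_comm]
    exact outer_slide _ _ _ _
  · subst h3 h4
    exact (simplicialDist_le_outer _ _).trans (outer_slide _ _ _ _)
  · subst h3 h2
    rw [h4] at h1
    cases h1
    exact (simplicialDist_inner_le _ _ _).trans (abs_sub_le _ _ _)

theorem eq_of_outer_eq_zero [hG : G.Connected] (p q : Realization G) (h : outer p q = 0) :
    p = q := by
  obtain ⟨b, c, h'⟩ := exists_outer p q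
  rw [h, via] at h'
  have hp := cost_nonneg p b
  have hq := cost_nonneg q c
  have hd : (0 : ℝ) ≤ G.toSimpleGraph.dist (p.exit b) (q.exit c) := Nat.cast_nonneg _
  rcases p with x | ⟨e, s⟩
  · rcases q with y | ⟨e', t⟩
    · have : (G.toSimpleGraph.dist x y : ℝ) = 0 := by
        simpa [cost, exit] using h'.symm
      have hxy : x = y := hG.connected.dist_eq_zero_iff.1 (by exact_mod_cast this)
      rw [hxy]
    · have := cost_inner_pos (G := G) e' t c
      linarith
  · have := cost_inner_pos (G := G) e s b
    linarith

theorem eq_of_simplicialDist_eq_zero [G.Connected] {p q : Realization G}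
    (h : simplicialDist p q = 0) : p = q := by
  rcases simplicialDist_cases p q with h' | ⟨e, s, t, rfl, rfl, h'⟩
  · exact eq_of_outer_eq_zero p q (h'.symm.trans h)
  · have hst : s = t := Subtype.ext (sub_eq_zero.1 (abs_eq_zero.1 (h'.symm.trans h)))
    rw [hst]

/-- A connected graph as a metric space with its simplicial metric. -/
noncomputable instance [G.Connected] : MetricSpace (Realization G) where
  dist := simplicialDist
  dist_self := simplicialDist_self
  dist_comm := simplicialDist_comm
  dist_triangle := simplicialDist_triangle
  eq_of_dist_eq_zero := eq_of_simplicialDist_eq_zero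

end Realization

/-- A subgraph: a set of vertices and a set of edges whose endpoints belong to the set of
vertices. -/
structure Subgraph (G : Multigraph V E) where
  verts : Set V
  edges : Set E
  src_mem : ∀ e ∈ edges, G.src e ∈ verts
  tgt_mem : ∀ e ∈ edges, G.tgt e ∈ verts

/-- A subgraph as a subset of the graph: its vertices and all points on its edges. -/
def Subgraph.carrier {G : Multigraph V E} (A : G.Subgraph) : Set G.Realization :=
  {p | match p with
    | .vert x => x ∈ A.verts
    | .inner e _ => e ∈ A.edges}

/-- The graph obtained from `G` by adding a new edge `e_{x,y,j}` with endpoints `x` and `y` for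
every `j` and all vertices `x`, `y` of the subgraph `A j`. -/
def coneOff (G : Multigraph V E) {J : Type w} (A : J → G.Subgraph) :
    Multigraph V (E ⊕ (Σ j, (A j).verts × (A j).verts)) where
  src := Sum.elim G.src fun f => f.2.1
  tgt := Sum.elim G.tgt fun f => f.2.2

instance (G : Multigraph V E) [hG : G.Connected] {J : Type w} (A : J → G.Subgraph) :
    (G.coneOff A).Connected where
  connected := by
    refine hG.connected.mono ?_
    intro x y h
    simp only [toSimpleGraph, SimpleGraph.fromRel_adj] at h ⊢
    refine ⟨h.1, ?_⟩
    rcases h.2 with ⟨e, he⟩ | ⟨e, he⟩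
    · exact Or.inl ⟨Sum.inl e, he⟩
    · exact Or.inr ⟨Sum.inl e, he⟩

/-- The inclusion of `G` as a subgraph of the coned-off graph. -/
def inclusion (G : Multigraph V E) {J : Type w} (A : J → G.Subgraph) :
    G.Realization → (G.coneOff A).Realization
  | .vert x => .vert x
  | .inner e t => .inner (Sum.inl e) t

end Multigraph

/-- `s` is (the image of) a geodesic from `x` to `y`. -/
def IsGeodesic {M : Type u} [MetricSpace M] (x y : M) (s : Set M) : Prop :=
  ∃ (l : ℝ) (γ : ℝ → M), 0 ≤ l ∧ γ 0 = x ∧ γ l = y ∧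
    (∀ a ∈ Set.Icc 0 l, ∀ b ∈ Set.Icc 0 l, dist (γ a) (γ b) = |a - b|) ∧
    s = γ '' Set.Icc 0 l

/-- `δ`-hyperbolicity of a geodesic metric space: every side of every geodesic triangle lies in
the closed `δ`-neighbourhood of the union of the two other sides. -/
def IsHyperbolic (δ : ℝ) (M : Type u) [MetricSpace M] : Prop :=
  ∀ (x y z : M) (a b c : Set M), IsGeodesic x y a → IsGeodesic y z b → IsGeodesic x z c →
    ∀ p ∈ a, ∃ q ∈ b ∪ c, dist p q ≤ δ

/-- `C`-quasiconvexity of a subset `A`: every geodesic between two points of `A` lies in the closed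
`C`-neighbourhood of `A`. -/
def IsQuasiconvex {M : Type u} [MetricSpace M] (C : ℝ) (A : Set M) : Prop :=
  ∀ x ∈ A, ∀ y ∈ A, ∀ s, IsGeodesic x y s → ∀ p ∈ s, ∃ q ∈ A, dist p q ≤ C

/-! The geodesics of `X`, seen in the cone-off `Y`, are preferred paths satisfying a "guessing
geodesics" criterion. Let `G ≤ H` be the simple graphs of `X` and `Y`. Two properties suffice:
triangles of `G`-geodesics are slim in the `H`-distance (`SlimIn`, inherited from hyperbolicity of
`X` since coning only shortens distances), and a `G`-geodesic with `H`-close endpoints stays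
`H`-close to its start (`ShortIn`). For the ends of a new edge the latter is quasiconvexity: the
geodesic stays near `X_j`, whose vertices are pairwise at `H`-distance at most 1.

Halving a path in `H` with `n` steps and using slimness at each halving puts a `G`-geodesic within
`O(log n)` of it (`SlimIn.exists_dist_le_of_chain`). Against a coarse geodesic of `H`, the farthest
point of the `G`-geodesic, at distance `k`, can be isolated in a quadrilateral of `H`-size `O(k)`.
Thus `k = O(log k)`, which bounds `k` (`SlimIn.exists_dist_le_closeness`). A connectedness argument
gives the converse closeness (`SlimIn.exists_dist_le_of_coarse`).

So geodesics of `Y` fellow-travel geodesics of `X`. This is the second claim, and it transports slim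
triangles to `Y`, which is the first. -/

namespace SimpleGraph

/-! ### Discrete geodesics -/

variable {V : Type*} {G H : SimpleGraph V}

/-- The vertices `u 0, …, u m` are the consecutive vertices of a geodesic of `G`. -/
def IsVertexGeodesic (G : SimpleGraph V) (u : ℕ → V) (m : ℕ) : Prop :=
  ∀ i k, i + k ≤ m → G.dist (u i) (u (i + k)) = k

theorem IsVertexGeodesic.dist_eq {u : ℕ → V} {m : ℕ} (h : G.IsVertexGeodesic u m) :
    G.dist (u 0) (u m) = m := by
  simpa using h 0 m (by omega)

theorem IsVertexGeodesic.reverse {u : ℕ → V} {m : ℕ} (h : G.IsVertexGeodesic u m) :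
    G.IsVertexGeodesic (fun i => u (m - i)) m := by
  intro i k hik
  have := h (m - (i + k)) k (by omega)
  rw [show m - (i + k) + k = m - i by omega] at this
  rw [dist_comm]
  exact this

theorem IsVertexGeodesic.shift {u : ℕ → V} {m : ℕ} (h : G.IsVertexGeodesic u m) {a n : ℕ}
    (ha : a + n ≤ m) : G.IsVertexGeodesic (fun i => u (a + i)) n := by
  intro i k hik
  have := h (a + i) k (by omega)
  simpa [add_assoc] using this

theorem IsVertexGeodesic.adj {u : ℕ → V} {m : ℕ} (h : G.IsVertexGeodesic u m) {i : ℕ}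
    (hi : i < m) : G.Adj (u i) (u (i + 1)) :=
  dist_eq_one_iff_adj.1 (h i 1 hi)

theorem dist_le_of_chain (hG : G.Connected) {u : ℕ → V} {m : ℕ}
    (h : ∀ i < m, G.dist (u i) (u (i + 1)) ≤ 1) (i k : ℕ) (hik : i + k ≤ m) :
    G.dist (u i) (u (i + k)) ≤ k := by
  induction k with
  | zero => simp
  | succ k ih =>
    have h1 := ih (by omega)
    have h2 := h (i + k) (by omega)
    have h3 := hG.dist_triangle (u := u i) (v := u (i + k)) (w := u (i + k + 1))
    rw [← add_assoc]
    omega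

theorem exists_isVertexGeodesic (hG : G.Connected) (x y : V) :
    ∃ u : ℕ → V, u 0 = x ∧ u (G.dist x y) = y ∧ G.IsVertexGeodesic u (G.dist x y) := by
  obtain ⟨p, hp⟩ := hG.exists_walk_length_eq_dist x y
  have h1 : p.getVert (G.dist x y) = y := by rw [← hp]; exact p.getVert_length
  have hc : ∀ i < G.dist x y, G.dist (p.getVert i) (p.getVert (i + 1)) ≤ 1 := fun i hi =>
    (dist_eq_one_iff_adj.2 (p.adj_getVert_succ (by omega))).le
  refine ⟨p.getVert, p.getVert_zero, h1, fun i k hik => ?_⟩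
  have hu := dist_le_of_chain hG hc
  refine le_antisymm (hu i k hik) ?_
  have ha := hu 0 i (by omega)
  have hb := hu (i + k) (G.dist x y - (i + k)) (by omega)
  rw [show i + k + (G.dist x y - (i + k)) = G.dist x y by omega, h1] at hb
  rw [zero_add, p.getVert_zero] at ha
  -- The three pieces of the shortest walk have upper bounds adding up to `G.dist x y`, so the
  -- middle one is attained.
  have h2 := hG.dist_triangle (u := x) (v := p.getVert i) (w := y)
  have h3 := hG.dist_triangle (u := p.getVert i) (v := p.getVert (i + k)) (w := y)
  omega

theorem dist_le_dist_of_le (hG : G.Connected) (hGH : G ≤ H) (x y : V) :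
    H.dist x y ≤ G.dist x y := by
  obtain ⟨p, hp⟩ := hG.exists_walk_length_eq_dist x y
  rw [← hp]
  simpa using dist_le (p.mapLe hGH)

/-! ### Slim triangles and logarithmic closeness -/

/-- Triangles of geodesics of `G` are `D`-slim for the distance of `H`. -/
def SlimIn (G H : SimpleGraph V) (D : ℕ) : Prop :=
  ∀ (u v w : ℕ → V) (m n k : ℕ), G.IsVertexGeodesic u m → G.IsVertexGeodesic v n →
    G.IsVertexGeodesic w k → v 0 = u 0 → v n = w 0 → w k = u m → ∀ i ≤ m,
      (∃ j ≤ n, H.dist (u i) (v j) ≤ D) ∨ ∃ j ≤ k, H.dist (u i) (w j) ≤ D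

/-- A geodesic of `G` whose endpoints are at distance at most `r` in `H` stays `B`-close, in `H`,
to its starting point. -/
def ShortIn (G H : SimpleGraph V) (r B : ℕ) : Prop :=
  ∀ (u : ℕ → V) (m : ℕ), G.IsVertexGeodesic u m → H.dist (u 0) (u m) ≤ r → ∀ i ≤ m,
    H.dist (u i) (u 0) ≤ B

/-- A geodesic of `G` is logarithmically close to every coarse path with the same endpoints. -/
theorem SlimIn.exists_dist_le_of_chain (hG : G.Connected) (hH : H.Connected) {D r B : ℕ}
    (hS : SlimIn G H D) (hB : ShortIn G H r B) (N : ℕ) :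
    ∀ (f : ℕ → V) (m : ℕ), m ≤ 2 ^ N → (∀ i < m, H.dist (f i) (f (i + 1)) ≤ r) →
      ∀ (u : ℕ → V) (k : ℕ), G.IsVertexGeodesic u k → u 0 = f 0 → u k = f m →
        ∀ i ≤ k, ∃ j ≤ m, H.dist (u i) (f j) ≤ D * N + B := by
  induction N with
  | zero =>
    intro f m hm hf u k hu h0 hk i hi
    refine ⟨0, by omega, ?_⟩
    rw [← h0]
    have : H.dist (u 0) (u k) ≤ r := by
      rw [h0, hk]
      rcases Nat.eq_zero_or_pos m with rfl | h
      · simp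
      · obtain rfl : m = 1 := by simp at hm; omega
        exact hf 0 h
    simpa using hB u k hu this i hi
  | succ N ih =>
    intro f m hm hf u k hu h0 hk i hi
    have h2 : 2 ^ (N + 1) = 2 * 2 ^ N := by ring
    -- Split the path at its midpoint: slimness moves `u i` by `D` onto a geodesic spanning one
    -- half, so each halving costs `D`.
    set a := m / 2 with ha
    obtain ⟨v, hv0, hv1, hv⟩ := exists_isVertexGeodesic hG (f 0) (f a)
    obtain ⟨w, hw0, hw1, hw⟩ := exists_isVertexGeodesic hG (f a) (f m)
    have hD : D * (N + 1) = D * N + D := by ring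
    rcases hS u v w k _ _ hu hv hw (hv0.trans h0.symm) (hv1.trans hw0.symm)
      (hw1.trans hk.symm) i hi with ⟨j, hj, hd⟩ | ⟨j, hj, hd⟩
    · obtain ⟨l, hl, hd'⟩ := ih f a (by omega) (fun i hi => hf i (by omega)) v _ hv hv0 hv1 j hj
      refine ⟨l, by omega, ?_⟩
      have := hH.dist_triangle (u := u i) (v := v j) (w := f l)
      omega
    · obtain ⟨l, hl, hd'⟩ := ih (fun i => f (a + i)) (m - a) (by omega)
        (fun i hi => by simpa [add_assoc] using hf (a + i) (by omega)) w _ hw (by simpa using hw0)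
        (by rw [hw1]; congr 1; omega) j hj
      refine ⟨a + l, by omega, ?_⟩
      have := hH.dist_triangle (u := u i) (v := w j) (w := f (a + l))
      omega

/-- An `H`-geodesic between the endpoints has at most 3 ≤ 2² steps, so two halvings give closeness
`2 * D + D` to it; its vertices are within 3 of the start. -/
theorem ShortIn.of_slimIn (hG : G.Connected) (hH : H.Connected) {D : ℕ}
    (hS : SlimIn G H D) (hB : ShortIn G H 1 D) : ShortIn G H 3 (3 * D + 3) := by
  intro u m hu hm i hi
  obtain ⟨f, hf0, hf1, hf⟩ := exists_isVertexGeodesic hH (u 0) (u m)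
  obtain ⟨j, hj, hd⟩ := hS.exists_dist_le_of_chain hG hH hB 2 f _ (by omega)
    (fun i hi => (hf i 1 hi).le) u m hu hf0.symm hf1.symm i hi
  have h1 := hf 0 j (by omega)
  rw [zero_add, hf0, dist_comm] at h1
  have := hH.dist_triangle (u := u i) (v := f j) (w := u 0)
  omega

/-! ### Stability: from logarithmic to uniform closeness -/

/-- With `L = log₂ k`, the bound `L + 10 ≤ 11 * 2 ^ (L / 2)` cancels half of the exponent in `2 ^ L
≤ k` and leaves `2 ^ (L / 2) ≤ 11 * D`. -/
theorem le_of_le_mul_log {D k : ℕ} (h : k ≤ D * (Nat.log 2 k + 10)) :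
    k ≤ 2 ^ (22 * D + 2) := by
  rcases Nat.eq_zero_or_pos k with rfl | hk
  · simp
  set L := Nat.log 2 k with hL
  have h1 : 2 ^ L ≤ k := Nat.pow_log_le_self 2 hk.ne'
  have h2 : k < 2 ^ (L + 1) := Nat.lt_pow_succ_log_self (by norm_num) k
  have h3 : 2 ^ (L / 2) * 2 ^ (L / 2) ≤ 2 ^ L := by
    rw [← pow_add]; exact Nat.pow_le_pow_right (by norm_num) (by omega)
  have h4 : L / 2 < 2 ^ (L / 2) := Nat.lt_two_pow_self
  have h5 : L + 10 ≤ 11 * 2 ^ (L / 2) := by omega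
  have h6 : 2 ^ (L / 2) * 2 ^ (L / 2) ≤ (11 * D) * 2 ^ (L / 2) :=
    calc _ ≤ D * (L + 10) := h3.trans (h1.trans h)
      _ ≤ D * (11 * 2 ^ (L / 2)) := Nat.mul_le_mul_left _ h5
      _ = _ := by ring
  have h7 : 2 ^ (L / 2) ≤ 11 * D := Nat.le_of_mul_le_mul_right h6 (by positivity)
  exact h2.le.trans (Nat.pow_le_pow_right (by norm_num) (by omega))

/-- Walking along a path towards `u i`, one meets a vertex at distance `R` from `u i`, unless the
path starts within `R` of `u i`. -/
theorem exists_dist_eq_or_zero (hH : H.Connected) {u : ℕ → V} (R : ℕ) (i : ℕ)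
    (h : ∀ j < i, H.dist (u j) (u (j + 1)) ≤ 1) :
    ∃ a ≤ i, H.dist (u a) (u i) ≤ R ∧ (a = 0 ∨ R ≤ H.dist (u a) (u i)) := by
  have key : ∀ n, ∀ a ≤ i, i = a + n → H.dist (u a) (u i) ≤ R ∨
      ∃ a ≤ i, H.dist (u a) (u i) ≤ R ∧ R ≤ H.dist (u a) (u i) := by
    intro n
    induction n with
    | zero => rintro a - rfl; left; simp
    | succ n ih =>
      intro a ha hn
      rcases ih (a + 1) (by omega) (by omega) with h1 | h1
      · by_cases h2 : H.dist (u a) (u i) ≤ R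
        · exact Or.inl h2
        · have h3 := h a (by omega)
          have h4 := hH.dist_triangle (u := u a) (v := u (a + 1)) (w := u i)
          exact Or.inr ⟨a + 1, by omega, h1, by omega⟩
      · exact Or.inr h1
  rcases key i 0 (by omega) (by omega) with h1 | ⟨a, h1, h2, h3⟩
  · exact ⟨0, by omega, h1, Or.inl rfl⟩
  · exact ⟨a, h1, h2, Or.inr h3⟩

/-- The sequence `f 0, …, f n` is a `(1, 3)`-quasigeodesic of `H`. -/
def IsCoarseGeodesic (H : SimpleGraph V) (f : ℕ → V) (n : ℕ) : Prop :=
  (∀ i < n, H.dist (f i) (f (i + 1)) ≤ 3) ∧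
    ∀ i k, i + k ≤ n → H.dist (f i) (f (i + k)) ≤ k + 3 ∧ k ≤ H.dist (f i) (f (i + k)) + 3

/-- A bound for the distance of a geodesic of `G` from a coarse geodesic of `H` with the same
endpoints. -/
def closeness (D : ℕ) : ℕ := 2 ^ (22 * D + 2)

/-- A geodesic of `G` between two vertices of a coarse geodesic is close to it. -/
theorem SlimIn.exists_dist_le_of_coarse_segment (hG : G.Connected) (hH : H.Connected) {D N : ℕ}
    (hS : SlimIn G H D) (hB : ShortIn G H 3 D) {f : ℕ → V} {n : ℕ} (hf : H.IsCoarseGeodesic f n)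
    {a b : ℕ} (ha : a ≤ n) (hb : b ≤ n) (hab : H.dist (f a) (f b) + 3 ≤ 2 ^ N)
    {u : ℕ → V} {m : ℕ} (hu : G.IsVertexGeodesic u m) (h0 : u 0 = f a) (h1 : u m = f b)
    {i : ℕ} (hi : i ≤ m) : ∃ j ≤ n, H.dist (u i) (f j) ≤ D * N + D := by
  have key : ∀ a b, a ≤ n → b ≤ n → a ≤ b → H.dist (f a) (f b) + 3 ≤ 2 ^ N →
      ∀ u : ℕ → V, G.IsVertexGeodesic u m → u 0 = f a → u m = f b → ∀ i ≤ m,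
        ∃ j ≤ n, H.dist (u i) (f j) ≤ D * N + D := by
    intro a b ha hb hle hab u hu h0 h1 i hi
    have hl := (hf.2 a (b - a) (by omega)).2
    rw [show a + (b - a) = b by omega] at hl
    obtain ⟨j, hj, hd⟩ := hS.exists_dist_le_of_chain hG hH hB N (fun i => f (a + i)) (b - a)
      (by omega) (fun i hi => by simpa [add_assoc] using hf.1 (a + i) (by omega)) u m hu
      (by simpa using h0) (by rw [h1]; congr 1; omega) i hi
    exact ⟨a + j, by omega, hd⟩
  rcases le_total a b with h | h
  · exact key a b ha hb h hab u hu h0 h1 i hi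
  · obtain ⟨j, hj, hd⟩ := key b a hb ha h (by rwa [dist_comm]) _ hu.reverse (by simpa using h1)
      (by simpa using h0) (m - i) (by omega)
    refine ⟨j, hj, ?_⟩
    simpa [show m - (m - i) = i by omega] using hd

/-- The point `z` lies on an `H`-geodesic between the endpoints. This handles the two short sides of
the quadrilateral in the stability argument. -/
theorem SlimIn.exists_dist_le_of_dist_le (hG : G.Connected) (hH : H.Connected) {D N : ℕ}
    (hS : SlimIn G H D) (hB : ShortIn G H 3 D) {u : ℕ → V} {m : ℕ} (hu : G.IsVertexGeodesic u m)
    (hN : H.dist (u 0) (u m) ≤ 2 ^ N) {i : ℕ} (hi : i ≤ m) :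
    ∃ z, H.dist (u i) z ≤ D * N + D ∧ H.dist z (u 0) ≤ H.dist (u 0) (u m) ∧
      H.dist z (u m) ≤ H.dist (u 0) (u m) := by
  obtain ⟨f, hf0, hf1, hf⟩ := exists_isVertexGeodesic hH (u 0) (u m)
  obtain ⟨j, hj, hd⟩ := hS.exists_dist_le_of_chain hG hH hB N f _ hN
    (fun i hi => (hf i 1 hi).le.trans (by norm_num)) u m hu hf0.symm hf1.symm i hi
  refine ⟨f j, hd, ?_, ?_⟩
  · have := hf 0 j (by omega)
    rw [zero_add, hf0, dist_comm] at this
    omega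
  · have := hf j (H.dist (u 0) (u m) - j) (by omega)
    rw [show j + (H.dist (u 0) (u m) - j) = H.dist (u 0) (u m) by omega, hf1] at this
    omega

/-- Stability: a geodesic of `G` stays close to a coarse geodesic of `H` with the same endpoints. -/
theorem SlimIn.exists_dist_le_closeness (hG : G.Connected) (hH : H.Connected) (hGH : G ≤ H)
    {D : ℕ} (hS : SlimIn G H D) (hB : ShortIn G H 3 D) {f : ℕ → V} {n : ℕ}
    (hf : H.IsCoarseGeodesic f n) {u : ℕ → V} {m : ℕ} (hu : G.IsVertexGeodesic u m)
    (h0 : u 0 = f 0) (h1 : u m = f n) {i : ℕ} (hi : i ≤ m) :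
    ∃ j ≤ n, H.dist (u i) (f j) ≤ closeness D := by
  have hne : (Finset.range (n + 1)).Nonempty := ⟨0, by simp⟩
  have hmin : ∀ i, ∃ j ≤ n, ∀ j' ≤ n, H.dist (u i) (f j) ≤ H.dist (u i) (f j') := fun i => by
    obtain ⟨j, hj, h⟩ := Finset.exists_min_image _ (fun j => H.dist (u i) (f j)) hne
    exact ⟨j, by simpa [Nat.lt_succ_iff] using hj,
      fun j' hj' => h j' (by simpa [Nat.lt_succ_iff] using hj')⟩
  choose J hJn hJ using hmin
  -- `u p` is a vertex of the `G`-geodesic farthest from the coarse geodesic, and `k` is its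
  -- distance.
  obtain ⟨p, hp, hmax⟩ := Finset.exists_max_image (Finset.range (m + 1))
    (fun i => H.dist (u i) (f (J i))) ⟨0, by simp⟩
  replace hp : p ≤ m := by simpa [Nat.lt_succ_iff] using hp
  replace hmax : ∀ i ≤ m, H.dist (u i) (f (J i)) ≤ H.dist (u p) (f (J p)) := fun i hi =>
    hmax i (by simpa [Nat.lt_succ_iff] using hi)
  set k := H.dist (u p) (f (J p)) with hk
  refine ⟨J i, hJn i, (hmax i hi).trans (le_of_le_mul_log ?_)⟩
  rcases Nat.eq_zero_or_pos k with hk0 | hkpos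
  · simp [hk0]
  have hstep : ∀ j < m, H.dist (u j) (u (j + 1)) ≤ 1 := fun j hj =>
    (dist_le_dist_of_le hG hGH _ _).trans (hu j 1 hj).le
  -- Go out from `u p` on both sides to distance `2 * k`, or to the end of the geodesic. There the
  -- distance to the coarse geodesic is at most `k`, and 0 at an end.
  obtain ⟨a, ha, ha1, ha2⟩ := exists_dist_eq_or_zero hH (u := u) (2 * k) p
    (fun j hj => hstep j (by omega))
  obtain ⟨b', hb', hb1, hb2⟩ := exists_dist_eq_or_zero hH (u := fun i => u (m - i)) (2 * k) (m - p)
    (fun j hj => by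
      have := hstep (m - (j + 1)) (by omega)
      rw [show m - (j + 1) + 1 = m - j by omega, dist_comm] at this
      exact this)
  simp only [show m - (m - p) = p by omega] at hb1 hb2
  obtain ⟨b, hb, hbm, rfl⟩ : ∃ b, p ≤ b ∧ b ≤ m ∧ b' = m - b := ⟨m - b', by omega, by omega, by omega⟩
  simp only [show m - (m - b) = b by omega] at hb1 hb2
  obtain ⟨ja, hja, hjak, hja2⟩ : ∃ ja ≤ n, H.dist (u a) (f ja) ≤ k ∧
      (u a = f ja ∨ 2 * k ≤ H.dist (u a) (u p)) := by
    rcases ha2 with rfl | h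
    · exact ⟨0, by omega, by simp [h0], Or.inl h0⟩
    · exact ⟨J a, hJn a, hmax a (by omega), Or.inr h⟩
  obtain ⟨jb, hjb, hjbk, hjb2⟩ : ∃ jb ≤ n, H.dist (f jb) (u b) ≤ k ∧
      (u b = f jb ∨ 2 * k ≤ H.dist (u b) (u p)) := by
    rcases hb2 with hbm' | h
    · obtain rfl : b = m := by omega
      exact ⟨n, le_rfl, by simp [h1], Or.inl h1⟩
    · exact ⟨J b, hJn b, by rw [dist_comm]; exact hmax b (by omega), Or.inr h⟩
  -- Chosen so that `2 ^ N` exceeds `6 * k + 3`, the size of the quadrilateral's longest side to be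
  -- compared with a path.
  set N := Nat.log 2 k + 5 with hN
  have hkN : 16 * k ≤ 2 ^ N := by
    have := Nat.lt_pow_succ_log_self (b := 2) (by norm_num) k
    rw [hN, show Nat.log 2 k + 5 = Nat.log 2 k + 1 + 4 by ring, pow_add]
    omega
  have hE : D * (Nat.log 2 k + 10) = D * N + D + D + D + D + D := by rw [hN]; ring
  rw [hE]
  have hab : H.dist (f ja) (f jb) ≤ 6 * k := by
    have e1 := hH.dist_triangle (u := f ja) (v := u a) (w := f jb)
    have e2 := hH.dist_triangle (u := u a) (v := u p) (w := f jb)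
    have e3 := hH.dist_triangle (u := u p) (v := u b) (w := f jb)
    rw [dist_comm (u := u p) (v := u b), dist_comm (u := u b) (v := f jb)] at e3
    rw [dist_comm (u := f ja) (v := u a)] at e1
    omega
  have hmain := hu.shift (a := a) (n := b - a) (by omega)
  obtain ⟨v, hv0, hv1, hv⟩ := exists_isVertexGeodesic hG (u a) (f ja)
  obtain ⟨w, hw0, hw1, hw⟩ := exists_isVertexGeodesic hG (f ja) (u b)
  obtain ⟨v', hv'0, hv'1, hv'⟩ := exists_isVertexGeodesic hG (f ja) (f jb)
  obtain ⟨w', hw'0, hw'1, hw'⟩ := exists_isVertexGeodesic hG (f jb) (u b)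
  have hub : u (a + (b - a)) = u b := by congr 1; omega
  have hup : u (a + (p - a)) = u p := by congr 1; omega
  -- The quadrilateral `u a`, `f ja`, `f jb`, `u b`, cut by the diagonal `w`: `u p` is within `2 *
  -- D` of one of the other three sides.
  have hs := hS _ v w _ _ _ hmain hv hw (by simpa using hv0) (hv1.trans hw0.symm)
    (by rw [hw1, hub]) (p - a) (by omega)
  simp only [hup] at hs
  rcases hs with ⟨j, hj, hd⟩ | ⟨j, hj, hd⟩
  · obtain ⟨z, hz, hz0, hz1⟩ := hS.exists_dist_le_of_dist_le hG hH hB hv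
      (N := N) (by rw [hv0, hv1]; omega) hj
    rw [hv0, hv1] at hz0 hz1
    have e1 := hH.dist_triangle (u := u p) (v := v j) (w := z)
    -- Near a short side, `z` is within `k` of `u a`, which is `2 * k` away from `u p`, so `z` is at
    -- least `k` away from `u p`. If the side is degenerate, `z` is itself on the coarse geodesic.
    rcases hja2 with h | h
    · rw [h] at hz1
      simp only [dist_self] at hz1
      have e2 := hH.dist_triangle (u := u p) (v := z) (w := f ja)
      have e3 := hJ p ja hja
      omega
    · have e2 := hH.dist_triangle (u := u p) (v := z) (w := u a)
      rw [dist_comm (u := u p) (v := u a)] at e2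
      omega
  · rcases hS w v' w' _ _ _ hw hv' hw' (hv'0.trans hw0.symm) (hv'1.trans hw'0.symm)
      (hw'1.trans hw1.symm) j hj with ⟨l, hl, hd'⟩ | ⟨l, hl, hd'⟩
    · obtain ⟨q, hq, hdq⟩ := hS.exists_dist_le_of_coarse_segment hG hH hB hf hja hjb (N := N)
        (by omega) hv' hv'0 hv'1 hl
      have e1 := hH.dist_triangle (u := u p) (v := w j) (w := f q)
      have e2 := hH.dist_triangle (u := w j) (v := v' l) (w := f q)
      have e3 := hJ p q hq
      omega
    · obtain ⟨z, hz, hz0, hz1⟩ := hS.exists_dist_le_of_dist_le hG hH hB hw'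
        (N := N) (by rw [hw'0, hw'1]; omega) hl
      rw [hw'0, hw'1] at hz0 hz1
      have e0 := hH.dist_triangle (u := u p) (v := w j) (w := z)
      have e1 := hH.dist_triangle (u := w j) (v := w' l) (w := z)
      rcases hjb2 with h | h
      · rw [h] at hz0
        simp only [dist_self] at hz0
        have e2 := hH.dist_triangle (u := u p) (v := z) (w := f jb)
        have e3 := hJ p jb hjb
        omega
      · have e2 := hH.dist_triangle (u := u p) (v := z) (w := u b)
        rw [dist_comm (u := u p) (v := u b)] at e2
        omega

/-- Conversely, the coarse geodesic stays close to the geodesic of `G`. -/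
theorem SlimIn.exists_dist_le_of_coarse (hG : G.Connected) (hH : H.Connected) (hGH : G ≤ H)
    {D : ℕ} (hS : SlimIn G H D) (hB : ShortIn G H 3 D) {f : ℕ → V} {n : ℕ}
    (hf : H.IsCoarseGeodesic f n) {u : ℕ → V} {m : ℕ} (hu : G.IsVertexGeodesic u m)
    (h0 : u 0 = f 0) (h1 : u m = f n) {j : ℕ} (hj : j ≤ n) :
    ∃ i ≤ m, H.dist (f j) (u i) ≤ 3 * closeness D + 7 := by
  have hclose := fun {i : ℕ} (hi : i ≤ m) =>
    hS.exists_dist_le_closeness hG hH hGH hB hf hu h0 h1 hi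
  set K := closeness D
  by_cases hlast : ∃ j' ≤ j, H.dist (u m) (f j') ≤ K
  · obtain ⟨j', hj', hd⟩ := hlast
    have e1 := (hf.2 j' (n - j') (by omega)).2
    have e2 := (hf.2 j (n - j) (by omega)).1
    rw [show j' + (n - j') = n by omega, dist_comm, ← h1] at e1
    rw [show j + (n - j) = n by omega, ← h1] at e2
    exact ⟨m, le_rfl, by omega⟩
  -- Take the first `u (i + 1)` not close to `f 0, …, f j`. It is close to some `f q` with `q > j`,
  -- while `u i` is close to some `f j'` with `j' ≤ j`. Hence `q - j'` is bounded, and `f j` lies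
  -- between them.
  · have hex : ∃ i, ¬ ∃ j' ≤ j, H.dist (u i) (f j') ≤ K := ⟨m, hlast⟩
    classical
    have hfind := Nat.find_spec hex
    have hle : Nat.find hex ≤ m := Nat.find_min' hex hlast
    have hpos : Nat.find hex ≠ 0 := fun h => by
      rw [h] at hfind
      exact hfind ⟨0, by omega, by simp [h0]⟩
    obtain ⟨i, hi⟩ := Nat.exists_eq_succ_of_ne_zero hpos
    have hprev := not_not.1 (Nat.find_min hex (m := i) (by omega))
    rw [hi] at hfind
    obtain ⟨j', hj', hd'⟩ := hprev
    obtain ⟨q, hq, hdq⟩ := hclose (i := i + 1) (by omega)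
    have hjq : j < q := by
      by_contra hcon
      exact hfind ⟨q, by omega, hdq⟩
    have e0 : H.dist (u i) (u (i + 1)) ≤ 1 :=
      (dist_le_dist_of_le hG hGH _ _).trans (hu i 1 (by omega)).le
    have e1 := (hf.2 j' (q - j') (by omega)).2
    have e2 := (hf.2 j' (j - j') (by omega)).1
    rw [show j' + (q - j') = q by omega] at e1
    rw [show j' + (j - j') = j by omega, dist_comm] at e2
    have e3 := hH.dist_triangle (u := f j') (v := u i) (w := f q)
    have e4 := hH.dist_triangle (u := u i) (v := u (i + 1)) (w := f q)
    have e5 := hH.dist_triangle (u := f j) (v := f j') (w := u i)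
    rw [dist_comm (u := f j') (v := u i)] at e3 e5
    exact ⟨i, by omega, by omega⟩

end SimpleGraph

/-! ### Geodesics in metric spaces -/

namespace IsGeodesic

variable {M : Type*} [MetricSpace M]

theorem reverse {x y : M} {s : Set M} (h : IsGeodesic x y s) : IsGeodesic y x s := by
  obtain ⟨l, γ, hl, h0, h1, hd, rfl⟩ := h
  refine ⟨l, fun t => γ (l - t), hl, by simpa, by simpa, fun a ha b hb => ?_, ?_⟩
  · rw [hd _ ⟨by linarith [ha.2], by linarith [ha.1]⟩ _ ⟨by linarith [hb.2], by linarith [hb.1]⟩,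
      abs_sub_comm]
    congr 1
    ring
  · ext p
    constructor
    · rintro ⟨t, ht, rfl⟩
      exact ⟨l - t, ⟨by linarith [ht.2], by linarith [ht.1]⟩, by simp⟩
    · rintro ⟨t, ht, rfl⟩
      exact ⟨l - t, ⟨by linarith [ht.2], by linarith [ht.1]⟩, rfl⟩

theorem refl (x : M) : IsGeodesic x x {x} :=
  ⟨0, fun _ => x, le_rfl, rfl, rfl, fun a ha b hb => by
    have : a = b := by linarith [ha.1, ha.2, hb.1, hb.2]
    simp [this], by simp⟩

theorem right_mem {x y : M} {s : Set M} (h : IsGeodesic x y s) : y ∈ s := by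
  obtain ⟨l, γ, hl, h0, h1, hd, rfl⟩ := h
  exact ⟨l, ⟨hl, le_rfl⟩, h1⟩

end IsGeodesic

/-- A bigon is a triangle with one side reduced to the point `y`, which already lies on `t`. -/
theorem IsHyperbolic.exists_dist_le_of_isGeodesic {M : Type*} [MetricSpace M] {δ : ℝ}
    (hM : IsHyperbolic δ M) {x y : M} {s t : Set M} (hs : IsGeodesic x y s)
    (ht : IsGeodesic x y t) {p : M} (hp : p ∈ s) : ∃ q ∈ t, dist p q ≤ δ := by
  obtain ⟨q, rfl | hq, hd⟩ := hM x y y s {y} t hs (IsGeodesic.refl y) ht p hp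
  · exact ⟨_, ht.right_mem, hd⟩
  · exact ⟨q, hq, hd⟩

/-! ### Between metric graphs and vertex sequences -/

namespace Multigraph

variable {V : Type*} {E : Type*} {G : Multigraph V E}

namespace Realization

theorem dist_vert_vert [G.Connected] (x y : V) :
    dist (vert x : Realization G) (vert y) = G.toSimpleGraph.dist x y := by
  change outer (vert x : Realization G) (vert y) = _
  simp [outer, via, cost, exit]

theorem dist_le_via [G.Connected] (p q : Realization G) (b c : Bool) : dist p q ≤ via p q b c :=
  (simplicialDist_le_outer p q).trans (outer_le p q b c)

theorem dist_vert_exit_le_cost [G.Connected] (p : Realization G) (b : Bool) :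
    dist p (vert (p.exit b)) ≤ p.cost b := by
  refine (dist_le_via p _ b b).trans ?_
  cases p <;> cases b <;> simp [via, exit, cost]

theorem dist_vert_exit_le_one [G.Connected] (p : Realization G) :
    dist p (vert (p.exit false)) ≤ 1 := by
  refine (dist_vert_exit_le_cost p false).trans ?_
  rcases p with x | ⟨e, t, h0, h1⟩
  · simp [cost]
  · exact h1.le

open Classical in
/-- The parametrization of an edge by the unit interval. -/
noncomputable def edgePoint (G : Multigraph V E) (e : E) (t : ℝ) : Realization G :=
  if h : t ∈ Set.Ioo (0 : ℝ) 1 then inner e ⟨t, h⟩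
  else if t ≤ 0 then vert (G.src e) else vert (G.tgt e)

theorem edgePoint_zero (e : E) : edgePoint G e 0 = vert (G.src e) := by simp [edgePoint]

theorem edgePoint_one (e : E) : edgePoint G e 1 = vert (G.tgt e) := by simp [edgePoint]

theorem edgePoint_of_mem (e : E) {t : ℝ} (h : t ∈ Set.Ioo (0 : ℝ) 1) :
    edgePoint G e t = inner e ⟨t, h⟩ := by
  simp only [edgePoint, h, dif_pos]

/-- Equality fails for loops, whose two ends coincide. -/
theorem dist_edgePoint_le [G.Connected] (e : E) {s t : ℝ} (hs : s ∈ Set.Icc (0 : ℝ) 1)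
    (ht : t ∈ Set.Icc (0 : ℝ) 1) : dist (edgePoint G e s) (edgePoint G e t) ≤ |s - t| := by
  have hzero : ∀ r ∈ Set.Icc (0 : ℝ) 1, dist (edgePoint G e r) (vert (G.src e)) ≤ r := by
    intro r hr
    rcases hr.1.eq_or_lt with rfl | h0
    · simp [edgePoint_zero]
    rcases hr.2.eq_or_lt with rfl | h1
    · rw [edgePoint_one, dist_comm, dist_vert_vert]
      exact_mod_cast dist_src_tgt G e
    · rw [edgePoint_of_mem e ⟨h0, h1⟩]
      exact dist_vert_exit_le_cost (inner e ⟨r, h0, h1⟩) false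
  have hone : ∀ r ∈ Set.Icc (0 : ℝ) 1, dist (edgePoint G e r) (vert (G.tgt e)) ≤ 1 - r := by
    intro r hr
    rcases hr.1.eq_or_lt with rfl | h0
    · rw [edgePoint_zero, dist_vert_vert, sub_zero]
      exact_mod_cast dist_src_tgt G e
    rcases hr.2.eq_or_lt with rfl | h1
    · simp [edgePoint_one]
    · rw [edgePoint_of_mem e ⟨h0, h1⟩]
      exact dist_vert_exit_le_cost (inner e ⟨r, h0, h1⟩) true
  have key : ∀ s ∈ Set.Icc (0 : ℝ) 1, ∀ t ∈ Set.Icc (0 : ℝ) 1, s ≤ t →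
      dist (edgePoint G e s) (edgePoint G e t) ≤ t - s := by
    intro s hs t ht hst
    rcases hs.1.eq_or_lt with rfl | h0
    · rw [edgePoint_zero, dist_comm, sub_zero]
      exact hzero t ht
    rcases ht.2.eq_or_lt with rfl | h1
    · rw [edgePoint_one]
      exact hone s hs
    · rw [edgePoint_of_mem e ⟨h0, hst.trans_lt h1⟩, edgePoint_of_mem e ⟨h0.trans_le hst, h1⟩]
      refine (simplicialDist_inner_le e _ _).trans (le_of_eq ?_)
      rw [abs_sub_comm]
      exact abs_of_nonneg (sub_nonneg.2 hst)
  rcases le_total s t with h | h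
  · rw [abs_sub_comm, abs_of_nonneg (sub_nonneg.2 h)]
    exact key s hs t ht h
  · rw [dist_comm, abs_of_nonneg (sub_nonneg.2 h)]
    exact key t ht s hs h

theorem exists_segment [G.Connected] {x y : V} (h : G.toSimpleGraph.Adj x y) :
    ∃ g : ℝ → Realization G, g 0 = vert x ∧ g 1 = vert y ∧
      ∀ s ∈ Set.Icc (0 : ℝ) 1, ∀ t ∈ Set.Icc (0 : ℝ) 1, dist (g s) (g t) ≤ |s - t| := by
  simp only [toSimpleGraph, SimpleGraph.fromRel_adj] at h
  rcases h.2 with ⟨e, rfl, rfl⟩ | ⟨e, rfl, rfl⟩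
  · exact ⟨edgePoint G e, edgePoint_zero e, edgePoint_one e, fun s hs t ht =>
      dist_edgePoint_le e hs ht⟩
  · refine ⟨fun r => edgePoint G e (1 - r), by simp [edgePoint_one], by simp [edgePoint_zero],
      fun s hs t ht => ?_⟩
    refine (dist_edgePoint_le e (s := 1 - s) (t := 1 - t) ⟨by linarith [hs.2], by linarith [hs.1]⟩
      ⟨by linarith [ht.2], by linarith [ht.1]⟩).trans (le_of_eq ?_)
    rw [abs_sub_comm]
    congr 1
    ring

/-- The vertices of a geodesic of the underlying simple graph lie on a geodesic of the metric
graph. -/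
theorem exists_geodesic_param [G.Connected] {u : ℕ → V} {m : ℕ}
    (hu : G.toSimpleGraph.IsVertexGeodesic u m) :
    ∃ σ : ℝ → Realization G, (∀ i : ℕ, σ i = vert (u i)) ∧
      ∀ a ∈ Set.Icc (0 : ℝ) m, ∀ b ∈ Set.Icc (0 : ℝ) m, dist (σ a) (σ b) = |a - b| := by
  have hseg : ∀ i, ∃ g : ℝ → Realization G, g 0 = vert (u i) ∧ (i < m → g 1 = vert (u (i + 1)) ∧
      ∀ s ∈ Set.Icc (0 : ℝ) 1, ∀ t ∈ Set.Icc (0 : ℝ) 1, dist (g s) (g t) ≤ |s - t|) := by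
    intro i
    by_cases hi : i < m
    · obtain ⟨g, h0, h1, h⟩ := exists_segment (hu.adj hi)
      exact ⟨g, h0, fun _ => ⟨h1, h⟩⟩
    · exact ⟨fun _ => vert (u i), rfl, fun h => absurd h hi⟩
  choose g hg0 hg using hseg
  let σ : ℝ → Realization G := fun t => g ⌊t⌋₊ (t - ⌊t⌋₊)
  have hσ : ∀ i : ℕ, σ i = vert (u i) := fun i => by simp [σ, hg0]
  have hloc : ∀ i : ℕ, i < m → ∀ a ∈ Set.Icc (i : ℝ) (i + 1), σ a = g i (a - i) := by
    intro i hi a ha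
    rcases ha.2.eq_or_lt with rfl | h
    · have := hσ (i + 1)
      push_cast at this
      rw [this, add_sub_cancel_left, (hg i hi).1]
    · have : ⌊a⌋₊ = i := (Nat.floor_eq_iff ((Nat.cast_nonneg i).trans ha.1)).2 ⟨ha.1, h⟩
      simp only [σ, this]
  have hlip : ∀ i : ℕ, i < m → ∀ a ∈ Set.Icc (i : ℝ) (i + 1), ∀ b ∈ Set.Icc (i : ℝ) (i + 1),
      dist (σ a) (σ b) ≤ |a - b| := by
    intro i hi a ha b hb
    rw [hloc i hi a ha, hloc i hi b hb]
    refine ((hg i hi).2 _ ⟨by linarith [ha.1], by linarith [ha.2]⟩ _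
      ⟨by linarith [hb.1], by linarith [hb.2]⟩).trans (le_of_eq ?_)
    congr 1
    ring
  have hupper : ∀ a b : ℝ, 0 ≤ a → a ≤ b → b ≤ m → dist (σ a) (σ b) ≤ b - a := by
    intro a b ha hab hb
    rcases hab.eq_or_lt with rfl | hlt
    · simp
    have ham : ⌊a⌋₊ < m := (Nat.floor_lt ha).2 (hlt.trans_le hb)
    have hfa := Nat.floor_le ha
    have hfa' := Nat.lt_floor_add_one a
    rcases le_total b (⌊a⌋₊ + 1) with h | h
    · refine (hlip _ ham a ⟨hfa, hfa'.le⟩ b ⟨hfa.trans hab, h⟩).trans (le_of_eq ?_)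
      rw [abs_sub_comm, abs_of_nonneg (sub_nonneg.2 hab)]
    have hb0 : 0 ≤ b := ha.trans hab
    have hfb := Nat.floor_le hb0
    have hle : ⌊a⌋₊ + 1 ≤ ⌊b⌋₊ := Nat.le_floor (by push_cast; exact h)
    have hbm : ⌊b⌋₊ ≤ m := Nat.floor_le_of_le hb
    have h1 : dist (σ a) (vert (u (⌊a⌋₊ + 1))) ≤ ⌊a⌋₊ + 1 - a := by
      rw [← hσ]
      refine (hlip _ ham a ⟨hfa, hfa'.le⟩ _ ⟨by simp, by simp⟩).trans (le_of_eq ?_)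
      push_cast
      rw [abs_sub_comm, abs_of_nonneg (by linarith)]
    have h2 : dist (vert (u (⌊a⌋₊ + 1)) : Realization G) (vert (u ⌊b⌋₊)) =
        (⌊b⌋₊ : ℝ) - (⌊a⌋₊ + 1) := by
      have := hu (⌊a⌋₊ + 1) (⌊b⌋₊ - (⌊a⌋₊ + 1)) (by omega)
      rw [show ⌊a⌋₊ + 1 + (⌊b⌋₊ - (⌊a⌋₊ + 1)) = ⌊b⌋₊ by omega] at this
      rw [dist_vert_vert, this, Nat.cast_sub hle]
      push_cast
      ring
    have h3 : dist (vert (u ⌊b⌋₊)) (σ b) ≤ b - ⌊b⌋₊ := by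
      rw [← hσ]
      rcases hbm.eq_or_lt with hbm | hbm
      · have : (⌊b⌋₊ : ℝ) = b := le_antisymm hfb (by rw [hbm]; exact hb)
        rw [this]
        simp
      · refine (hlip _ hbm _ ⟨le_rfl, by simp⟩ b
          ⟨hfb, (Nat.lt_floor_add_one b).le⟩).trans (le_of_eq ?_)
        rw [abs_sub_comm, abs_of_nonneg (by linarith)]
    have h4 := dist_triangle4 (σ a) (vert (u (⌊a⌋₊ + 1))) (vert (u ⌊b⌋₊)) (σ b)
    linarith
  -- A 1-Lipschitz path of length `m` whose ends are at distance `m` is isometric.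
  have heq : ∀ a b : ℝ, 0 ≤ a → a ≤ b → b ≤ m → dist (σ a) (σ b) = b - a := by
    intro a b ha hab hb
    refine le_antisymm (hupper a b ha hab hb) ?_
    have h1 := hupper 0 a le_rfl ha (hab.trans hb)
    have h2 := hupper b m (ha.trans hab) hb le_rfl
    have h3 := dist_triangle4 (σ 0) (σ a) (σ b) (σ m)
    have h4 : dist (σ 0) (σ m) = m := by
      have h0 := hσ 0
      rw [Nat.cast_zero] at h0
      rw [h0, hσ m, dist_vert_vert, hu.dist_eq]
    linarith
  refine ⟨σ, hσ, fun a ha b hb => ?_⟩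
  rcases le_total a b with h | h
  · rw [abs_sub_comm, abs_of_nonneg (sub_nonneg.2 h)]
    exact heq a b ha.1 h hb.2
  · rw [dist_comm, abs_of_nonneg (sub_nonneg.2 h)]
    exact heq b a hb.1 h ha.2

theorem exists_isGeodesic [G.Connected] {u : ℕ → V} {m : ℕ}
    (hu : G.toSimpleGraph.IsVertexGeodesic u m) :
    ∃ s : Set (Realization G), IsGeodesic (vert (u 0)) (vert (u m)) s ∧
      (∀ i ≤ m, vert (u i) ∈ s) ∧ ∀ p ∈ s, ∃ i ≤ m, dist p (vert (u i)) ≤ 1 := by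
  obtain ⟨σ, hσ, hd⟩ := exists_geodesic_param hu
  have h0 := hσ 0
  rw [Nat.cast_zero] at h0
  refine ⟨σ '' Set.Icc 0 m, ⟨m, σ, by positivity, h0, hσ m, hd, rfl⟩, fun i hi => ?_, ?_⟩
  · exact ⟨i, ⟨by positivity, by exact_mod_cast hi⟩, hσ i⟩
  · rintro _ ⟨t, ht, rfl⟩
    have h1 := Nat.floor_le ht.1
    have h2 := Nat.lt_floor_add_one t
    refine ⟨⌊t⌋₊, Nat.floor_le_of_le ht.2, ?_⟩
    rw [← hσ, hd t ht _ ⟨by positivity, h1.trans ht.2⟩, abs_of_nonneg (by linarith)]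
    linarith

/-- A geodesic of the metric graph is close to a coarse geodesic of the underlying simple graph. -/
theorem exists_isCoarseGeodesic [G.Connected] {p q : Realization G} {s : Set (Realization G)}
    (hs : IsGeodesic p q s) :
    ∃ (f : ℕ → V) (n : ℕ), G.toSimpleGraph.IsCoarseGeodesic f n ∧ f 0 = p.exit false ∧
      f n = q.exit false ∧ (∀ r ∈ s, ∃ i ≤ n, dist r (vert (f i)) ≤ 2) ∧
      ∀ i ≤ n, ∃ r ∈ s, dist (vert (f i)) r ≤ 1 := by
  obtain ⟨l, γ, hl, h0, h1, hd, rfl⟩ := hs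
  have hmem : ∀ i : ℕ, min (i : ℝ) l ∈ Set.Icc 0 l := fun i =>
    ⟨le_min (Nat.cast_nonneg i) hl, min_le_right _ _⟩
  -- Sample at integer times, capped at `l`, and round to a vertex. Rounding costs 1 at each end and
  -- the truncated last step costs 1 more, whence the constant 3.
  set f : ℕ → V := fun i => (γ (min i l)).exit false with hf
  have hfd : ∀ i : ℕ, dist (γ (min i l)) (vert (f i)) ≤ 1 := fun i => dist_vert_exit_le_one _
  have hceil := Nat.le_ceil l
  have hceil' := Nat.ceil_lt_add_one hl
  have hmm : ∀ i k : ℕ, i + k ≤ ⌈l⌉₊ → dist (γ (min i l)) (γ (min (i + k : ℕ) l)) ≤ k ∧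
      (k : ℝ) ≤ dist (γ (min i l)) (γ (min (i + k : ℕ) l)) + 1 := by
    intro i k hik
    rw [hd _ (hmem _) _ (hmem _)]
    have hik' : (i : ℝ) + k ≤ ⌈l⌉₊ := by exact_mod_cast hik
    have hk : (0 : ℝ) ≤ k := Nat.cast_nonneg k
    push_cast
    rcases le_total ((i : ℝ) + k) l with h | h
    · rw [min_eq_left h, min_eq_left (by linarith), abs_sub_comm, abs_of_nonneg (by linarith)]
      constructor <;> linarith
    · rw [min_eq_right h]
      rcases le_total (i : ℝ) l with h' | h'
      · rw [min_eq_left h', abs_sub_comm, abs_of_nonneg (by linarith)]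
        constructor <;> linarith
      · rw [min_eq_right h']
        simp only [sub_self, abs_zero]
        constructor <;> linarith
  have hcoarse : ∀ i k, i + k ≤ ⌈l⌉₊ →
      G.toSimpleGraph.dist (f i) (f (i + k)) ≤ k + 2 ∧
        k ≤ G.toSimpleGraph.dist (f i) (f (i + k)) + 3 := by
    intro i k hik
    obtain ⟨e1, e2⟩ := hmm i k hik
    have e3 := hfd i
    have e4 := hfd (i + k)
    have e5 := dist_triangle4 (vert (f i)) (γ (min i l)) (γ (min (i + k : ℕ) l)) (vert (f (i + k)))
    have e6 := dist_triangle4 (γ (min i l)) (vert (f i)) (vert (f (i + k))) (γ (min (i + k : ℕ) l))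
    rw [dist_comm (vert (f i)) (γ (min i l)), dist_vert_vert] at e5
    rw [dist_comm (vert (f (i + k))) (γ (min (i + k : ℕ) l)), dist_vert_vert] at e6
    have e7 : (G.toSimpleGraph.dist (f i) (f (i + k)) : ℝ) ≤ (k + 2 : ℕ) := by
      push_cast; linarith
    have e8 : (k : ℝ) ≤ (G.toSimpleGraph.dist (f i) (f (i + k)) + 3 : ℕ) := by
      push_cast; linarith
    exact ⟨by exact_mod_cast e7, by exact_mod_cast e8⟩
  refine ⟨f, ⌈l⌉₊, ⟨fun i hi => by simpa using (hcoarse i 1 hi).1, fun i k hik =>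
    ⟨(hcoarse i k hik).1.trans (by omega), (hcoarse i k hik).2⟩⟩, ?_, ?_, ?_, ?_⟩
  · simp [hf, min_eq_left hl, h0]
  · simp [hf, min_eq_right hceil, h1]
  · rintro _ ⟨t, ht, rfl⟩
    have e1 := Nat.floor_le ht.1
    have e2 := Nat.lt_floor_add_one t
    refine ⟨⌊t⌋₊, (Nat.floor_mono ht.2).trans (Nat.floor_le_ceil l), ?_⟩
    have e3 := hfd ⌊t⌋₊
    have e4 := dist_triangle (γ t) (γ (min (⌊t⌋₊ : ℝ) l)) (vert (f ⌊t⌋₊))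
    rw [hd t ht _ (hmem _), min_eq_left (e1.trans ht.2), abs_of_nonneg (by linarith)] at e4
    rw [min_eq_left (e1.trans ht.2)] at e3
    linarith
  · intro i hi
    exact ⟨_, ⟨_, hmem i, rfl⟩, by rw [dist_comm]; exact hfd i⟩

end Realization

open Realization

theorem Connected.toSimpleGraph_connected (G : Multigraph V E) [hG : G.Connected] :
    G.toSimpleGraph.Connected := hG.connected

/-! ### The cone-off satisfies `SlimIn` and `ShortIn` -/

section ConeOff

variable {J : Type*} (A : J → G.Subgraph)

theorem toSimpleGraph_le_coneOff : G.toSimpleGraph ≤ (G.coneOff A).toSimpleGraph := by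
  intro x y h
  simp only [toSimpleGraph, SimpleGraph.fromRel_adj] at h ⊢
  refine ⟨h.1, ?_⟩
  rcases h.2 with ⟨e, he⟩ | ⟨e, he⟩
  · exact Or.inl ⟨Sum.inl e, he⟩
  · exact Or.inr ⟨Sum.inl e, he⟩

theorem coneOff_adj {x y : V} (h : (G.coneOff A).toSimpleGraph.Adj x y) :
    G.toSimpleGraph.Adj x y ∨ ∃ j, x ∈ (A j).verts ∧ y ∈ (A j).verts := by
  simp only [toSimpleGraph, SimpleGraph.fromRel_adj] at h ⊢
  rcases h.2 with ⟨e | ⟨j, a, b⟩, rfl, rfl⟩ | ⟨e | ⟨j, a, b⟩, rfl, rfl⟩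
  · exact Or.inl ⟨h.1, Or.inl ⟨e, rfl, rfl⟩⟩
  · exact Or.inr ⟨j, a.2, b.2⟩
  · exact Or.inl ⟨h.1, Or.inr ⟨e, rfl, rfl⟩⟩
  · exact Or.inr ⟨j, b.2, a.2⟩

theorem coneOff_dist_le_one {j : J} {x y : V} (hx : x ∈ (A j).verts) (hy : y ∈ (A j).verts) :
    (G.coneOff A).toSimpleGraph.dist x y ≤ 1 :=
  dist_src_tgt (G.coneOff A) (Sum.inr ⟨j, ⟨x, hx⟩, ⟨y, hy⟩⟩)

theorem exit_mem_verts {B : G.Subgraph} {p : Realization G} (hp : p ∈ B.carrier) :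
    p.exit false ∈ B.verts := by
  rcases p with x | ⟨e, t⟩
  · exact hp
  · exact B.src_mem e hp

variable [G.Connected]

theorem coneOff_dist_le (x y : V) :
    (G.coneOff A).toSimpleGraph.dist x y ≤ G.toSimpleGraph.dist x y :=
  SimpleGraph.dist_le_dist_of_le (Connected.toSimpleGraph_connected G)
    (toSimpleGraph_le_coneOff A) x y

/-- Positions inside edges are unchanged, and distances between vertices can only decrease. -/
theorem dist_inclusion_le (p q : Realization G) :
    dist (G.inclusion A p) (G.inclusion A q) ≤ dist p q := by
  have hcost : ∀ (p : Realization G) b, (G.inclusion A p).cost b = p.cost b := by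
    rintro (x | ⟨e, t⟩) (_ | _) <;> rfl
  have hexit : ∀ (p : Realization G) b, (G.inclusion A p).exit b = p.exit b := by
    rintro (x | ⟨e, t⟩) (_ | _) <;> rfl
  rcases simplicialDist_cases p q with h | ⟨e, s, t, rfl, rfl, h⟩
  · change _ ≤ simplicialDist p q
    rw [h]
    obtain ⟨b, c, h'⟩ := exists_outer p q
    rw [h']
    refine (dist_le_via _ _ b c).trans ?_
    unfold via
    rw [hcost, hcost, hexit, hexit]
    have : ((G.coneOff A).toSimpleGraph.dist (p.exit b) (q.exit c) : ℝ) ≤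
        G.toSimpleGraph.dist (p.exit b) (q.exit c) := by
      exact_mod_cast coneOff_dist_le A _ _
    linarith
  · change _ ≤ simplicialDist _ _
    rw [h]
    exact simplicialDist_inner_le _ s t

theorem slimIn_of_isHyperbolic {δ : ℝ} {D : ℕ} (hG : IsHyperbolic δ G.Realization)
    (hD : δ + 1 ≤ D) : G.toSimpleGraph.SlimIn (G.coneOff A).toSimpleGraph D := by
  intro u v w m n k hu hv hw hvu hvw hwu i hi
  obtain ⟨a, ha, hai, -⟩ := exists_isGeodesic hu
  obtain ⟨c, hc, -, hcn⟩ := exists_isGeodesic hv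
  obtain ⟨b, hb, -, hbn⟩ := exists_isGeodesic hw
  rw [hvu, hvw] at hc
  rw [hwu] at hb
  have key : ∀ z q, dist (vert (u i) : Realization G) q ≤ δ → dist q (vert z) ≤ 1 →
      (G.coneOff A).toSimpleGraph.dist (u i) z ≤ D := by
    intro z q h1 h2
    refine (coneOff_dist_le A _ _).trans ?_
    have h3 := dist_triangle (vert (u i)) q (vert z)
    rw [dist_vert_vert] at h3
    have : (G.toSimpleGraph.dist (u i) z : ℝ) ≤ D := by linarith
    exact_mod_cast this
  obtain ⟨q, hq | hq, hd⟩ := hG _ _ _ a b c ha hb.reverse hc _ (hai i hi)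
  · obtain ⟨j, hj, hd'⟩ := hbn q hq
    exact Or.inr ⟨j, hj, key _ q hd hd'⟩
  · obtain ⟨j, hj, hd'⟩ := hcn q hq
    exact Or.inl ⟨j, hj, key _ q hd hd'⟩

theorem shortIn_of_isQuasiconvex {C : ℝ} {D : ℕ} (hA : ∀ j, IsQuasiconvex C (A j).carrier)
    (hC : 0 ≤ C) (hD : C + 2 ≤ D) : G.toSimpleGraph.ShortIn (G.coneOff A).toSimpleGraph 1 D := by
  intro u m hu hm i hi
  have hH := Connected.toSimpleGraph_connected (G.coneOff A)
  have hD2 : 2 ≤ D := by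
    have : (2 : ℝ) ≤ D := by linarith
    exact_mod_cast this
  have hshort : m ≤ 1 → (G.coneOff A).toSimpleGraph.dist (u i) (u 0) ≤ D := by
    intro h1
    have := hu 0 i (by omega)
    rw [zero_add, SimpleGraph.dist_comm] at this
    exact (coneOff_dist_le A _ _).trans (by omega)
  rcases Nat.le_one_iff_eq_zero_or_eq_one.1 hm with h | h
  · have := hH.dist_eq_zero_iff.1 h
    refine hshort ?_
    rw [← hu.dist_eq, ← this]
    simp
  · rcases coneOff_adj A (SimpleGraph.dist_eq_one_iff_adj.1 h) with h | ⟨j, h0, h1⟩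
    · refine hshort ?_
      rw [← hu.dist_eq, SimpleGraph.dist_eq_one_iff_adj.2 h]
    · obtain ⟨s, hs, hsi, -⟩ := exists_isGeodesic hu
      -- Quasiconvexity costs `C`, rounding `q` to a vertex of `A j` costs 1, and a new edge from
      -- there to `u 0` costs 1.
      obtain ⟨q, hq, hd⟩ := hA j _ h0 _ h1 s hs _ (hsi i hi)
      have e1 := dist_vert_exit_le_one q
      have e2 := dist_triangle (vert (u i)) q (vert (q.exit false))
      rw [dist_vert_vert] at e2
      have e3 : (G.toSimpleGraph.dist (u i) (q.exit false) + 1 : ℝ) ≤ D := by linarith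
      have e4 : G.toSimpleGraph.dist (u i) (q.exit false) + 1 ≤ D := by exact_mod_cast e3
      have e5 := coneOff_dist_le A (u i) (q.exit false)
      have e6 := coneOff_dist_le_one A (exit_mem_verts hq) h0
      have e7 := hH.dist_triangle (u := u i) (v := q.exit false) (w := u 0)
      omega

end ConeOff

/-- The additive constant for the comparison of geodesics in a graph and in its cone-off. -/
noncomputable def coneOffConstant (D : ℕ) : ℕ := 4 * SimpleGraph.closeness D + D + 10

/-! ### Comparing geodesics of the graph and of its cone-off -/

section Comparison

variable {J : Type*} {A : J → G.Subgraph} [G.Connected] {D : ℕ}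

/-- A geodesic of the cone-off is close to every geodesic of the graph with nearby endpoints. -/
theorem exists_vertex_close_of_isGeodesic_coneOff
    (hS : G.toSimpleGraph.SlimIn (G.coneOff A).toSimpleGraph D)
    (hB : G.toSimpleGraph.ShortIn (G.coneOff A).toSimpleGraph 3 D)
    {p q : (G.coneOff A).Realization}
    {t : Set (G.coneOff A).Realization} (ht : IsGeodesic p q t) {u : ℕ → V} {m : ℕ}
    (hu : G.toSimpleGraph.IsVertexGeodesic u m) (h0 : u 0 = p.exit false)
    (h1 : u m = q.exit false) :
    (∀ r ∈ t, ∃ i ≤ m, dist r (vert (u i)) ≤ 3 * SimpleGraph.closeness D + 9) ∧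
      ∀ i ≤ m, ∃ r ∈ t, dist (vert (u i)) r ≤ SimpleGraph.closeness D + 1 := by
  have hG := Connected.toSimpleGraph_connected G
  have hH := Connected.toSimpleGraph_connected (G.coneOff A)
  have hGH := toSimpleGraph_le_coneOff A
  obtain ⟨f, n, hf, hf0, hf1, htf, hft⟩ := exists_isCoarseGeodesic ht
  constructor
  · intro r hr
    obtain ⟨j, hj, hd⟩ := htf r hr
    obtain ⟨i, hi, hd'⟩ := hS.exists_dist_le_of_coarse hG hH hGH hB hf hu (h0.trans hf0.symm)
      (h1.trans hf1.symm) hj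
    refine ⟨i, hi, ?_⟩
    have h2 := dist_triangle r (vert (f j)) (vert (u i))
    rw [dist_vert_vert] at h2
    have h3 : ((G.coneOff A).toSimpleGraph.dist (f j) (u i) : ℝ) ≤
      3 * SimpleGraph.closeness D + 7 := by exact_mod_cast hd'
    linarith
  · intro i hi
    obtain ⟨j, hj, hd⟩ := hS.exists_dist_le_closeness hG hH hGH hB hf hu (h0.trans hf0.symm)
      (h1.trans hf1.symm) hi
    obtain ⟨r, hr, hd'⟩ := hft j hj
    refine ⟨r, hr, ?_⟩
    have h2 := dist_triangle (vert (u i)) (vert (f j)) r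
    rw [dist_vert_vert] at h2
    have h3 : ((G.coneOff A).toSimpleGraph.dist (u i) (f j) : ℝ) ≤ SimpleGraph.closeness D := by
      exact_mod_cast hd
    linarith

theorem isHyperbolic_coneOff
    (hS : G.toSimpleGraph.SlimIn (G.coneOff A).toSimpleGraph D)
    (hB : G.toSimpleGraph.ShortIn (G.coneOff A).toSimpleGraph 3 D) :
    IsHyperbolic (coneOffConstant D) (G.coneOff A).Realization := by
  intro x y z a b c ha hb hc p hp
  have hG := Connected.toSimpleGraph_connected G
  obtain ⟨u, hu0, hu1, hu⟩ :=
    SimpleGraph.exists_isVertexGeodesic hG (x.exit false) (y.exit false)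
  obtain ⟨v, hv0, hv1, hv⟩ :=
    SimpleGraph.exists_isVertexGeodesic hG (x.exit false) (z.exit false)
  obtain ⟨w, hw0, hw1, hw⟩ :=
    SimpleGraph.exists_isVertexGeodesic hG (z.exit false) (y.exit false)
  obtain ⟨i, hi, hd⟩ :=
    (exists_vertex_close_of_isGeodesic_coneOff hS hB ha hu hu0 hu1).1 p hp
  -- From side to `X`-geodesic, across the slim triangle, and back: `(3K + 9) + D + (K + 1)`, with
  -- `K` the closeness bound.
  have key : ∀ v' r, (G.coneOff A).toSimpleGraph.dist (u i) v' ≤ D →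
      dist (vert v' : (G.coneOff A).Realization) r ≤ SimpleGraph.closeness D + 1 →
      dist p r ≤ coneOffConstant D := by
    intro v' r h1 h2
    have h3 := dist_triangle4 p (vert (u i)) (vert v') r
    rw [dist_vert_vert (u i)] at h3
    have h4 : ((G.coneOff A).toSimpleGraph.dist (u i) v' : ℝ) ≤ D := by exact_mod_cast h1
    unfold coneOffConstant
    push_cast
    linarith
  rcases hS u v w _ _ _ hu hv hw (hv0.trans hu0.symm) (hv1.trans hw0.symm) (hw1.trans hu1.symm)
    i hi with ⟨j, hj, hd'⟩ | ⟨j, hj, hd'⟩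
  · obtain ⟨r, hr, hd''⟩ :=
      (exists_vertex_close_of_isGeodesic_coneOff hS hB hc hv hv0 hv1).2 j hj
    exact ⟨r, Or.inr hr, key _ r hd' hd''⟩
  · obtain ⟨r, hr, hd''⟩ :=
      (exists_vertex_close_of_isGeodesic_coneOff hS hB hb.reverse hw hw0 hw1).2 j hj
    exact ⟨r, Or.inl hr, key _ r hd' hd''⟩

theorem hausdorffEDist_inclusion_le
    (hS : G.toSimpleGraph.SlimIn (G.coneOff A).toSimpleGraph D)
    (hB : G.toSimpleGraph.ShortIn (G.coneOff A).toSimpleGraph 3 D)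
    {δ : ℝ} (hδ : IsHyperbolic δ G.Realization) (hD : δ ≤ D)
    {x y : V} {s : Set G.Realization} {t : Set (G.coneOff A).Realization}
    (hs : IsGeodesic (vert x) (vert y) s) (ht : IsGeodesic (vert x) (vert y) t) :
    Metric.hausdorffEDist (G.inclusion A '' s) t ≤ ENNReal.ofReal (coneOffConstant D) := by
  have hG := Connected.toSimpleGraph_connected G
  obtain ⟨u, hu0, hu1, hu⟩ := SimpleGraph.exists_isVertexGeodesic hG x y
  obtain ⟨hclose, hclose'⟩ := exists_vertex_close_of_isGeodesic_coneOff hS hB ht hu hu0 hu1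
  obtain ⟨σ, hσ, hσu, huσ⟩ := exists_isGeodesic hu
  rw [hu0, hu1] at hσ
  have hK : (coneOffConstant D : ℝ) = 4 * SimpleGraph.closeness D + D + 10 := by
    simp [coneOffConstant]
  have hK0 : (0 : ℝ) ≤ SimpleGraph.closeness D := Nat.cast_nonneg _
  refine Metric.hausdorffEDist_le_of_mem_edist ?_ ?_
  · rintro _ ⟨p, hp, rfl⟩
    -- The given `X`-geodesic need not follow the vertices `u i`; a bigon in `X` compares it with
    -- one that does.
    obtain ⟨q, hq, hd⟩ := hδ.exists_dist_le_of_isGeodesic hs hσ hp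
    obtain ⟨i, hi, hd'⟩ := huσ q hq
    obtain ⟨r, hr, hd''⟩ := hclose' i hi
    refine ⟨r, hr, ?_⟩
    rw [edist_dist]
    refine ENNReal.ofReal_le_ofReal ?_
    have h1 := dist_inclusion_le A p (vert (u i))
    have h2 := dist_triangle p q (vert (u i))
    have h3 := dist_triangle (G.inclusion A p) (vert (u i)) r
    change dist _ (vert (u i)) ≤ _ at h1
    linarith
  · intro r hr
    obtain ⟨i, hi, hd⟩ := hclose r hr
    obtain ⟨p, hp, hd'⟩ := hδ.exists_dist_le_of_isGeodesic hσ hs (hσu i hi)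
    refine ⟨_, ⟨p, hp, rfl⟩, ?_⟩
    rw [edist_dist]
    refine ENNReal.ofReal_le_ofReal ?_
    have h1 := dist_inclusion_le A (vert (u i)) p
    have h3 := dist_triangle r (vert (u i)) (G.inclusion A p)
    change dist (vert (u i)) _ ≤ _ at h1
    linarith

end Comparison

end Multigraph

theorem proposition2p5 (δ₀ C : ℝ) (hC : 0 < C) :
    ∃ δ₁ : ℝ, 0 < δ₁ ∧ ∃ H : ℝ, 0 < H ∧
      ∀ (V : Type u) (E : Type v) (J : Type w) (X : Multigraph V E) [X.Connected]
        (A : J → X.Subgraph),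
        IsHyperbolic δ₀ X.Realization →
        (∀ j, IsQuasiconvex C (A j).carrier) →
        IsHyperbolic δ₁ (X.coneOff A).Realization ∧
        ∀ (x y : V) (s : Set X.Realization) (t : Set (X.coneOff A).Realization),
          IsGeodesic (.vert x) (.vert y) s →
          IsGeodesic (.vert x) (.vert y) t →
          Metric.hausdorffEDist (X.inclusion A '' s) t ≤ ENNReal.ofReal H := by
  obtain ⟨D, hD⟩ := exists_nat_ge (max (δ₀ + 1) (C + 2))
  have hδD : δ₀ + 1 ≤ D := (le_max_left _ _).trans hD
  have hCD : C + 2 ≤ D := (le_max_right _ _).trans hD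
  have hpos : (0 : ℝ) < Multigraph.coneOffConstant (3 * D + 3) := by
    unfold Multigraph.coneOffConstant
    positivity
  refine ⟨_, hpos, _, hpos, fun V E J X _ A hX hA => ?_⟩
  have hG := Multigraph.Connected.toSimpleGraph_connected X
  have hH := Multigraph.Connected.toSimpleGraph_connected (X.coneOff A)
  have hD' : (D : ℝ) ≤ (3 * D + 3 : ℕ) := by exact_mod_cast (by omega : D ≤ 3 * D + 3)
  -- Slimness with `D` yields shortness with `3 * D + 3`; slimness is then weakened to that same
  -- constant.
  have hS := Multigraph.slimIn_of_isHyperbolic A hX (hδD.trans hD')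
  have hB := SimpleGraph.ShortIn.of_slimIn hG hH (Multigraph.slimIn_of_isHyperbolic A hX hδD)
    (Multigraph.shortIn_of_isQuasiconvex A hA hC.le hCD)
  exact ⟨Multigraph.isHyperbolic_coneOff hS hB, fun x y s t hs ht =>
    Multigraph.hausdorffEDist_inclusion_le hS hB hX (by linarith) hs ht⟩
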